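/- **Setting.** Let $d\ge 2$, let $\mathcal T_h$ be a conforming simplicial mesh of a polyhedral domain $\Omega\subset\mathbb R^d$, with interior facets $\mathcal E_h^I$; for $e=\partial K^+\cap\partial K^-\in\mathcal E_h^I$ let $\boldsymbol n_e$ be the unit normal pointing from $K^+$ to $K^-$, $[\psi]_e=\psi^+-\psi^-$, and $h_e=\operatorname{diam} e$. Let $\mathcal Q_h$ be the space of piecewise constant functions and $\mathcal U_h^0$ the lowest-order Raviart–Thomas space with zero normal component on $\partial\Omega$. Consider a mixture of $M\ge1$ components at temperature $T>0$ with the Peng–Robinson Helmholtz free energy density $f(\mathbf c)$, chemical potentials $\mu_i=\partial f/\partial c_i$, covolumes $\beta_i$, mixture covolume $\beta(\mathbf c)=\sum_i\frac{c_i}{\sum_k c_k}\beta_i$, and $\beta^*=\max_i\beta_i$. Let $\theta_n,\varsigma,\epsilon>0$ and $\tau_{\max}$ be real parameters, $R$ the gas constant, and let $\mathcal K_e>0$ be the (facet-averaged) permeability. Given are the densities $c^n_{i,h}\in\mathcal Q_h$ ($1\le i\le M$) with total $c_h^n=\sum_i c_{i,h}^n$ and the porosity $\phi^n_h\in\mathcal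 Q_h$ at time $t^n$, and the porosity $\phi_h^{n+1,l}\in\mathcal Q_h$ and velocities $\boldsymbol u_{i,h}^{n+1,l}\in\mathcal U_h^0$ of the $l$-th iterate. On a facet $e$ let $c^{n*}_{i,h}=c^n_{i,h}|_{K^+}$ if $\boldsymbol u_{i,h}^{n+1,l}\cdot\boldsymbol n_e\ge0$ and $c^{n*}_{i,h}=c^n_{i,h}|_{K^-}$ otherwise. With time step $\tau=\tau_n^{l+1}$, the densities $c_h^{n+1,l+1}$ and $c_{i,h}^{n+1,l+1}$ ($i\le M-1$) in $\mathcal Q_h$ of the next iterate satisfy, for all $q_h\in\mathcal Q_h$, $$\Big(\tfrac{\phi_h^{n+1,l}c_h^{n+1,l+1}-\phi_h^nc_h^n}{\tau},q_h\Big)+\sum_{e\in\mathcal E_h^I}\Big\langle\sum_{i=1}^M c_{i,h}^{n*}\boldsymbol u_{i,h}^{n+1,l}\cdot\boldsymbol n_e,[q_h]\Big\rangle_e+\sum_{e\in\mathcal E_h^I}\frac{\varsigma}{h_e}\langle\mathcal K_e[\mu_h^{n+1,l+1}],[q_h]\rangle_e=0,$$ $$\Big(\tfrac{\phi_h^{n+1,l}c_{i,h}^{n+1,l+1}-\phi_h^nc_{i,h}^n}{\tau},q_h\Big)+\sum_{e\in\mathcal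 E_h^I}\langle c_{i,h}^{n*}\boldsymbol u_{i,h}^{n+1,l}\cdot\boldsymbol n_e,[q_h]\rangle_e+\sum_{e\in\mathcal E_h^I}\frac{\varsigma}{h_e}\langle\mathcal K_e[\mu_{i,h}^{n+1,l+1}],[q_h]\rangle_e=0,\quad i\le M-1,$$ where $\mu_{i,h}^{n+1,l+1}=\mu_i(\mathbf c_h^n)+\theta_nRT\frac{c_{i,h}^{n+1,l+1}-c_{i,h}^n}{c_h^n(1-\beta^*c_h^n)}$ and $\mu_{h}^{n+1,l+1}=\sum_{i=1}^M\mu_i(\mathbf c_h^n)+\theta_nRT\frac{c_h^{n+1,l+1}-c_h^n}{c_h^n(1-\beta^*c_h^n)}$. The last component is $c_{M,h}^{n+1,l+1}=c_h^{n+1,l+1}-\sum_{i=1}^{M-1}c_{i,h}^{n+1,l+1}$. **Theorem.** Assume $0<\beta^*c_h^n<1$. Let $\delta_{i,1},\delta_{i,2}$ ($1\le i\le M$) be constants with $0<\delta_{i,1},\delta_{i,2}<c_{i,h}^n/c_h^n$ on every element, and let $\delta_1,\delta_2<1$ be constants with $\sum_i\delta_{i,1}\le\delta_1$ and $\sum_i\delta_{i,2}\le\delta_2$.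 Suppose that the time step $\tau=\tau_n^{l+1}$ is positive and is given by $$\tau_n^{l+1}=\min_i\min_{K\in\mathcal T_h}\min\big(\tau_*^{i,l+1},\tau_\star^{i,l+1},\tau_{\max}\big),$$ $$\tau_*^{i,l+1}=\frac{\big(\phi_h^{n+1,l}c_h^n(1-\beta^*c_h^n)\delta_{i,1}-(\phi_h^{n+1,l}-\phi_h^n)c_{i,h}^n\big)|K|}{\sum_{e\in\partial K^+_{\boldsymbol u_i}}c_{i,h}^n\boldsymbol u_{i,h}^{n+1,l}\cdot\boldsymbol n|e|+\sum_{e\in\partial K^+_{\mu_i}}\frac{\varsigma}{h_e}\mathcal K_e[\mu_i(\mathbf c_h^n)]|e|+\epsilon},$$ $$\tau_\star^{i,l+1}=\frac{\big(\phi_h^{n+1,l}c_h^n(1-\beta^*c_h^n)\delta_{i,2}+(\phi_h^{n+1,l}-\phi_h^n)c_{i,h}^n\big)|K|}{-\Big(\sum_{e\in\partial K^-_{\boldsymbol u_i}}c_{i,h}^{n*}\boldsymbol u_{i,h}^{n+1,l}\cdot\boldsymbol n|e|+\sum_{e\in\partial K^-_{\mu_i}}\frac{\varsigma}{h_e}\mathcal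 K_e[\mu_i(\mathbf c_h^n)]|e|\Big)+\epsilon}.$$ Here, on the facets of $K$, $\boldsymbol n$ is the unit normal pointing out of $K$ and $[\psi]$ is the value in $K$ minus the value in the neighbour ($0$ on $\partial\Omega$); $\partial K^{\pm}_{\boldsymbol u_i}$ and $\partial K^\pm_{\mu_i}$ are the sets of facets $e$ of $K$ with $\pm\boldsymbol u_{i,h}^{n+1,l}\cdot\boldsymbol n|_e>0$ and with $\pm[\mu_i(\mathbf c_h^n)]_e>0$, respectively. Then on every element $$0<\big(1-\delta_1(1-\beta^*c_h^n)\big)c_h^n\le c_h^{n+1,l+1}\le\big(1+\delta_2(1-\beta^*c_h^n)\big)c_h^n<\frac1{\beta^*}\le\frac1\beta,$$ $$0<c_{i,h}^{n+1,l+1}\le c_h^{n+1,l+1},\qquad i=1,\dots,M,$$ where $\beta$ is the mixture covolume either at $\mathbf c_h^n$ or at $\mathbf c_h^{n+1,l+1}$, and $1/\beta^*<1/\beta$ is strict unless all $\beta_i$ coincide. -/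

import Mathlib

open MeasureTheory Finset

noncomputable section

/-! ### Peng--Robinson mixture -/

/-- The universal gas constant in J/(mol K). -/
def gasConstant : ℝ := 8.314

/-- Thermodynamic data of a mixture with components indexed by `ι`: (constant) temperature,
critical temperatures and pressures, acentric factors and binary interaction parameters. -/
structure Mixture (ι : Type) where
  temp : ℝ
  critTemp : ι → ℝ
  critPressure : ι → ℝ
  acentric : ι → ℝ
  interaction : ι → ι → ℝ
  temp_pos : 0 < temp
  critTemp_pos : ∀ i, 0 < critTemp i
  critPressure_pos : ∀ i, 0 < critPressure i
  interaction_self : ∀ i, interaction i i = 0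
  interaction_symm : ∀ i j, interaction i j = interaction j i

namespace Mixture

variable {ι : Type} (X : Mixture ι)

/-- The parameter `χ_i`, a polynomial in the acentric factor. -/
def chi (i : ι) : ℝ :=
  if X.acentric i ≤ 0.49 then
    0.37464 + 1.54226 * X.acentric i - 0.26992 * X.acentric i ^ 2
  else
    0.379642 + 1.485030 * X.acentric i - 0.164423 * X.acentric i ^ 2
      + 0.016666 * X.acentric i ^ 3

/-- The energy parameter `α_i` of a pure component. -/
def alpha (i : ι) : ℝ :=
  0.45724 * (gasConstant ^ 2 * X.critTemp i ^ 2 / X.critPressure i)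
    * (1 + X.chi i * (1 - Real.sqrt (X.temp / X.critTemp i))) ^ 2

/-- The covolume parameter `β_i` of a pure component. -/
def beta (i : ι) : ℝ :=
  0.07780 * (gasConstant * X.critTemp i / X.critPressure i)

variable [Fintype ι]

/-- `β* = max_i β_i`. -/
def betaStar [Nonempty ι] : ℝ := Finset.univ.sup' Finset.univ_nonempty X.beta

/-- Mixing rule for the energy parameter, as a function of the molar densities `x`. -/
def mixAlpha (x : ι → ℝ) : ℝ :=
  ∑ i, ∑ j, x i * x j / (∑ k, x k) ^ 2 * Real.sqrt (X.alpha i * X.alpha j)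
    * (1 - X.interaction i j)

/-- Mixing rule for the covolume parameter `β`, as a function of the molar densities `x`. -/
def mixBeta (x : ι → ℝ) : ℝ := ∑ i, x i / (∑ k, x k) * X.beta i

/-- The Helmholtz free energy density `f`. -/
def freeEnergy (x : ι → ℝ) : ℝ :=
  gasConstant * X.temp * ∑ i, x i * (Real.log (x i) - 1)
    - (∑ i, x i) * gasConstant * X.temp * Real.log (1 - X.mixBeta x * ∑ i, x i)
    + X.mixAlpha x * (∑ i, x i) / (2 * Real.sqrt 2 * X.mixBeta x)
      * Real.log ((1 + (1 - Real.sqrt 2) * (X.mixBeta x * ∑ i, x i))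
          / (1 + (1 + Real.sqrt 2) * (X.mixBeta x * ∑ i, x i)))

open Classical in
/-- The chemical potential `μ_i = ∂f/∂x_i`. -/
def chemPotential (i : ι) (x : ι → ℝ) : ℝ :=
  deriv (fun s : ℝ => X.freeEnergy (Function.update x i s)) (x i)

end Mixture

/-! ### Simplicial meshes -/

/-- A conforming simplicial mesh of a `d`-dimensional polyhedral domain: a nonempty finite
geometric simplicial complex in `ℝ^d`, each simplex of which is a face of a `d`-simplex. -/
structure Mesh (d : ℕ) extends Geometry.SimplicialComplex ℝ (EuclideanSpace ℝ (Fin d)) where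
  faces_nonempty : faces.Nonempty
  faces_finite : faces.Finite
  pure : ∀ s ∈ faces, ∃ t ∈ faces, s ⊆ t ∧ t.card = d + 1

namespace Mesh

variable {d : ℕ} (T : Mesh d)

/-- The elements `K` of the mesh, given by their vertex sets. -/
def Cell : Type := {s : Finset (EuclideanSpace ℝ (Fin d)) // s ∈ T.faces ∧ s.card = d + 1}

/-- The facets `e` of the mesh (edges if `d = 2`, faces if `d = 3`), given by their vertex sets. -/
def Facet : Type := {s : Finset (EuclideanSpace ℝ (Fin d)) // s ∈ T.faces ∧ s.card = d}

instance : Finite T.Cell :=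
  (T.faces_finite.subset (fun _ h => h.1) :
    {s : Finset (EuclideanSpace ℝ (Fin d)) | s ∈ T.faces ∧ s.card = d + 1}.Finite).to_subtype

instance : Finite T.Facet :=
  (T.faces_finite.subset (fun _ h => h.1) :
    {s : Finset (EuclideanSpace ℝ (Fin d)) | s ∈ T.faces ∧ s.card = d}.Finite).to_subtype

instance : Nonempty T.Cell := by
  obtain ⟨s, hs⟩ := T.faces_nonempty
  obtain ⟨t, ht, _, hc⟩ := T.pure s hs
  exact ⟨⟨t, ht, hc⟩⟩

instance : Fintype T.Cell := Fintype.ofFinite _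

instance : Fintype T.Facet := Fintype.ofFinite _

variable {T}

/-- The closed simplex occupied by an element. -/
def Cell.hull (K : T.Cell) : Set (EuclideanSpace ℝ (Fin d)) := convexHull ℝ (K.1 : Set _)

/-- The closed simplex occupied by a facet. -/
def Facet.hull (e : T.Facet) : Set (EuclideanSpace ℝ (Fin d)) := convexHull ℝ (e.1 : Set _)

/-- The measure `|K|`. -/
def Cell.meas (K : T.Cell) : ℝ := volume.real K.hull

/-- The `(d-1)`-dimensional measure `|e|`. -/
def Facet.meas (e : T.Facet) : ℝ := μHE[d - 1].real e.hull

/-- The facet diameter `h_e`. -/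
def Facet.diam (e : T.Facet) : ℝ := Metric.diam e.hull

/-- `n` is the unit normal on the facet `e` pointing out of the element `K`. -/
def IsOutwardUnitNormal (K : T.Cell) (e : T.Facet) (n : EuclideanSpace ℝ (Fin d)) : Prop :=
  ‖n‖ = 1 ∧ (∀ x ∈ e.1, ∀ y ∈ e.1, inner ℝ n (x - y) = 0) ∧
    ∀ x ∈ e.1, ∀ v ∈ K.1, inner ℝ n (v - x) ≤ 0

variable (T)

/-- The choice, for every interior facet `e`, of the names `K⁺ = plus e` and `K⁻ = minus e` of the
two adjacent elements, with the unit normal `n_e` pointing from `K⁺` to `K⁻`. On a boundary facet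
both names stand for the only adjacent element, and `n_e` points out of it. -/
structure Orientation where
  plus : T.Facet → T.Cell
  minus : T.Facet → T.Cell
  normal : T.Facet → EuclideanSpace ℝ (Fin d)
  adjacent : ∀ (e : T.Facet) (K : T.Cell), e.1 ⊆ K.1 ↔ K = plus e ∨ K = minus e
  normal_plus : ∀ e, IsOutwardUnitNormal (plus e) e (normal e)
  normal_minus : ∀ e, plus e ≠ minus e → IsOutwardUnitNormal (minus e) e (-normal e)

/-- The space `Q_h` of piecewise constant functions. -/
abbrev Q : Type := T.Cell → ℝ

/-- Piecewise defined vector fields: `v K` is the restriction of the field to `K`. -/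
abbrev VField : Type := T.Cell → EuclideanSpace ℝ (Fin d) → EuclideanSpace ℝ (Fin d)

variable {T}

/-- The `L²` inner product on `Q_h`. -/
def l2 (f g : T.Q) : ℝ := ∑ K : T.Cell, ∫ _x in K.hull, f K * g K

/-- The `L²(e)` inner product. -/
def facetInner (e : T.Facet) (f g : EuclideanSpace ℝ (Fin d) → ℝ) : ℝ :=
  ∫ x in e.hull, f x * g x ∂μHE[d - 1]

namespace Orientation

variable (o : T.Orientation)

open Classical in
/-- The set of interior facets. -/
def interior : Finset T.Facet := Finset.univ.filter fun e => o.plus e ≠ o.minus e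

/-- The jump `[ψ]_e = ψ⁺ - ψ⁻`. -/
def jump (ψ : T.Q) (e : T.Facet) : ℝ := ψ (o.plus e) - ψ (o.minus e)

/-- The lowest-order Raviart--Thomas space with vanishing normal component on the boundary. A
field that is piecewise in `P_0^d + x P_0` lies in `H(div)` iff its normal component is continuous
across the interior facets. -/
def RT0zero : Set T.VField :=
  {v | (∀ K, ∃ (a : EuclideanSpace ℝ (Fin d)) (b : ℝ), ∀ x, v K x = a + b • x) ∧
    (∀ e, o.plus e ≠ o.minus e → ∀ x ∈ e.hull,
      inner ℝ (v (o.plus e) x) (o.normal e) = inner ℝ (v (o.minus e) x) (o.normal e)) ∧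
    (∀ e, o.plus e = o.minus e → ∀ x ∈ e.hull, inner ℝ (v (o.plus e) x) (o.normal e) = 0)}

/-- The value of `v · n_e` on the facet `e`. For Raviart--Thomas fields it is constant on `e`; it
is read off at the barycentre of `e`, from the side of `K⁺`. -/
def normalComp (v : T.VField) (e : T.Facet) : ℝ :=
  inner ℝ (v (o.plus e) (e.1.centroid ℝ id)) (o.normal e)

/-- The upwind value of `c` on the facet `e` for the velocity `v`. -/
def upwind (v : T.VField) (c : T.Q) (e : T.Facet) : ℝ :=
  open Classical in if 0 ≤ o.normalComp v e then c (o.plus e) else c (o.minus e)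

open Classical in
/-- The facets of the element `K`. -/
def facetsOf (_o : T.Orientation) (K : T.Cell) : Finset T.Facet :=
  Finset.univ.filter fun e => e.1 ⊆ K.1

/-- `v · n` on the facet `e` of `K`, for the unit normal `n` pointing out of `K`. -/
def outNormalComp (v : T.VField) (K : T.Cell) (e : T.Facet) : ℝ :=
  open Classical in if K = o.plus e then o.normalComp v e else -o.normalComp v e

/-- The jump of `ψ` on the facet `e` of `K`, oriented outwards: the value in `K` minus the value
in the neighbour (zero on boundary facets). -/
def outJump (ψ : T.Q) (K : T.Cell) (e : T.Facet) : ℝ :=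
  open Classical in if K = o.plus e then o.jump ψ e else -o.jump ψ e

end Orientation

/-! ### The linearized scheme -/

/-- Total molar density of a family of component densities. -/
def total {m : ℕ} (c : Fin (m + 1) → T.Q) : T.Q := fun K => ∑ i, c i K

/-- All component densities, recovered from the total density `ct` and the densities `cp` of all
components but the last. -/
def components {m : ℕ} (ct : T.Q) (cp : Fin m → T.Q) : Fin (m + 1) → T.Q :=
  Fin.snoc (α := fun _ => T.Q) cp (fun K => ct K - ∑ i, cp i K)

/-- The chemical potential `μ_i(c^n)` of the previous time level. -/
def muOld {m : ℕ} (X : Mixture (Fin (m + 1))) (cn : Fin (m + 1) → T.Q) (i : Fin (m + 1)) : T.Q :=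
  fun K => X.chemPotential i (fun j => cn j K)

/-- The stabilization increment `θ R T (c - cOld) / (c^n (1 - β* c^n))`. -/
def stab {m : ℕ} (X : Mixture (Fin (m + 1))) (θ : ℝ) (cn : Fin (m + 1) → T.Q) (c cOld : T.Q) :
    T.Q := fun K =>
  θ * gasConstant * X.temp * ((c K - cOld K) / (total cn K * (1 - X.betaStar * total cn K)))

/-- The mass conservation equations of one linear iteration within a time step: `cn`, `φn` are the
densities and porosity of the old time level, `φl`, `u` the porosity and the velocities of the
previous iterate, `τ` the time step, `kap e` the permeability on `e`, `ς` the penalty parameter,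
`ct` and `cp` the total density and the densities of all components but the last of the new
iterate. -/
structure IsLinearIterate {m : ℕ} (o : T.Orientation) (X : Mixture (Fin (m + 1))) (θ ς τ : ℝ)
    (kap : T.Facet → ℝ) (cn : Fin (m + 1) → T.Q) (φn φl : T.Q) (u : Fin (m + 1) → T.VField)
    (ct : T.Q) (cp : Fin m → T.Q) : Prop where
  total_eq : ∀ q : T.Q,
    l2 (fun K => (φl K * ct K - φn K * total cn K) / τ) q
      + ∑ e ∈ o.interior,
          facetInner e
            (fun x => ∑ i, o.upwind (u i) (cn i) e
              * inner ℝ (u i (o.plus e) x) (o.normal e))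
            (fun _ => o.jump q e)
      + ∑ e ∈ o.interior, ς / e.diam *
          facetInner e
            (fun _ => kap e * o.jump (fun K => (∑ i, muOld X cn i K)
              + stab X θ cn ct (total cn) K) e)
            (fun _ => o.jump q e) = 0
  component_eq : ∀ (i : Fin m) (q : T.Q),
    l2 (fun K => (φl K * cp i K - φn K * cn i.castSucc K) / τ) q
      + ∑ e ∈ o.interior,
          facetInner e
            (fun x => o.upwind (u i.castSucc) (cn i.castSucc) e
              * inner ℝ (u i.castSucc (o.plus e) x) (o.normal e))
            (fun _ => o.jump q e)
      + ∑ e ∈ o.interior, ς / e.diam *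
          facetInner e
            (fun _ => kap e * o.jump (fun K => muOld X cn i.castSucc K
              + stab X θ cn (cp i) (cn i.castSucc) K) e)
            (fun _ => o.jump q e) = 0

/-! ### The adaptive time step -/

open Classical in
/-- The quotient `τ_*^i` on the element `K`. -/
def tauLower {m : ℕ} (o : T.Orientation) (X : Mixture (Fin (m + 1))) (ς ε : ℝ)
    (kap : T.Facet → ℝ) (cn : Fin (m + 1) → T.Q) (φn φl : T.Q) (u : Fin (m + 1) → T.VField)
    (δ : Fin (m + 1) → ℝ) (i : Fin (m + 1)) (K : T.Cell) : ℝ :=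
  (φl K * total cn K * (1 - X.betaStar * total cn K) * δ i - (φl K - φn K) * cn i K) * K.meas /
    (∑ e ∈ (o.facetsOf K).filter (fun e => 0 < o.outNormalComp (u i) K e),
        cn i K * o.outNormalComp (u i) K e * e.meas
      + ∑ e ∈ (o.facetsOf K).filter (fun e => 0 < o.outJump (muOld X cn i) K e),
        ς / e.diam * (kap e * o.outJump (muOld X cn i) K e) * e.meas
      + ε)

open Classical in
/-- The quotient `τ_⋆^i` on the element `K`. -/
def tauUpper {m : ℕ} (o : T.Orientation) (X : Mixture (Fin (m + 1))) (ς ε : ℝ)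
    (kap : T.Facet → ℝ) (cn : Fin (m + 1) → T.Q) (φn φl : T.Q) (u : Fin (m + 1) → T.VField)
    (δ : Fin (m + 1) → ℝ) (i : Fin (m + 1)) (K : T.Cell) : ℝ :=
  (φl K * total cn K * (1 - X.betaStar * total cn K) * δ i + (φl K - φn K) * cn i K) * K.meas /
    (-(∑ e ∈ (o.facetsOf K).filter (fun e => o.outNormalComp (u i) K e < 0),
          o.upwind (u i) (cn i) e * o.outNormalComp (u i) K e * e.meas
        + ∑ e ∈ (o.facetsOf K).filter (fun e => o.outJump (muOld X cn i) K e < 0),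
          ς / e.diam * (kap e * o.outJump (muOld X cn i) K e) * e.meas)
      + ε)

/-- The adaptive time step: the minimum of `τ_*^i`, `τ_⋆^i`, `τ_max` over all components and
elements. -/
def adaptiveTau {m : ℕ} (o : T.Orientation) (X : Mixture (Fin (m + 1))) (ς ε τmax : ℝ)
    (kap : T.Facet → ℝ) (cn : Fin (m + 1) → T.Q) (φn φl : T.Q) (u : Fin (m + 1) → T.VField)
    (δlo δup : Fin (m + 1) → ℝ) : ℝ :=
  Finset.univ.inf' (Finset.univ_nonempty (α := Fin (m + 1) × T.Cell)) fun p =>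
    min (min (tauLower o X ς ε kap cn φn φl u δlo p.1 p.2)
      (tauUpper o X ς ε kap cn φn φl u δup p.1 p.2)) τmax

end Mesh

end

/-! The argument is a discrete maximum principle for the relative increment z_i = (c_i^{new} -
c_i^n) / (c^n (1 - β* c^n)), on which the stabilization acts as a penalty with coefficient θRT ≥ 0.

Testing with the indicator of an element turns the weak equations into local balances. These are
additive over the components, so subtracting the first M - 1 of them from the total balance gives
the same balance for the last component (`IsLinearIterate.cellBalance_eq_zero`).

On an element where z_i is minimal, every outward jump of z_i is ≤ 0, so the stabilization only
brings mass in. The net outflow is then at most the upwind outflow plus the positive jumps of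
μ_i(c^n), which is the denominator of τ_* without ε (`flux_le_sum_outflow`). The bound τ ≤ τ_*
becomes z_i ≥ -δ_{i,1} there, hence everywhere (`neg_le_relIncrement`). A maximal element gives z_i
≤ δ_{i,2} in the same way (`sum_inflow_le_flux`, `relIncrement_le`).

Since δ_{i,1} < c_i^n / c^n, the lower bound keeps each c_i positive, and c_i ≤ c follows because
the components sum to c. Summing the bounds over i controls the total density. The comparison of
1/β* with 1/β holds because β is a weighted mean of the β_i. -/

namespace Mixture

/-! ### Covolumes: the mixture value as a weighted mean. -/

variable {ι : Type} (X : Mixture ι)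

theorem gasConstant_pos : 0 < gasConstant := by norm_num [gasConstant]

theorem beta_pos (i : ι) : 0 < X.beta i := by
  have h1 := X.critTemp_pos i
  have h2 := X.critPressure_pos i
  have h3 := gasConstant_pos
  unfold beta
  positivity

variable [Fintype ι]

theorem mixBeta_eq_div (y : ι → ℝ) : X.mixBeta y = (∑ i, y i * X.beta i) / ∑ i, y i := by
  unfold mixBeta
  rw [Finset.sum_div]
  exact Finset.sum_congr rfl fun i _ => by ring

variable [Nonempty ι]

theorem beta_le_betaStar (i : ι) : X.beta i ≤ X.betaStar :=
  Finset.le_sup' X.beta (Finset.mem_univ i)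

theorem betaStar_pos : 0 < X.betaStar :=
  (X.beta_pos (Classical.arbitrary ι)).trans_le (X.beta_le_betaStar _)

theorem mixBeta_pos {y : ι → ℝ} (hy : ∀ i, 0 < y i) : 0 < X.mixBeta y := by
  rw [mixBeta_eq_div]
  exact div_pos (Finset.sum_pos (fun i _ => mul_pos (hy i) (X.beta_pos i)) Finset.univ_nonempty)
    (Finset.sum_pos (fun i _ => hy i) Finset.univ_nonempty)

theorem mixBeta_le_betaStar {y : ι → ℝ} (hy : ∀ i, 0 < y i) : X.mixBeta y ≤ X.betaStar := by
  rw [mixBeta_eq_div, div_le_iff₀ (Finset.sum_pos (fun i _ => hy i) Finset.univ_nonempty),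
    mul_comm, Finset.sum_mul]
  exact Finset.sum_le_sum fun i _ => mul_le_mul_of_nonneg_left (X.beta_le_betaStar i) (hy i).le

/-- If the β_i do not all coincide, some β_k lies below the maximum, and its weight y_k is positive.
-/
theorem mixBeta_lt_betaStar {y : ι → ℝ} (hy : ∀ i, 0 < y i)
    (hne : ∃ i j, X.beta i ≠ X.beta j) : X.mixBeta y < X.betaStar := by
  obtain ⟨k, hk⟩ : ∃ k, X.beta k < X.betaStar := by
    by_contra! hcon
    obtain ⟨i, j, hij⟩ := hne
    exact hij (((X.beta_le_betaStar i).antisymm (hcon i)).trans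
      ((X.beta_le_betaStar j).antisymm (hcon j)).symm)
  rw [mixBeta_eq_div, div_lt_iff₀ (Finset.sum_pos (fun i _ => hy i) Finset.univ_nonempty),
    mul_comm, Finset.sum_mul]
  exact Finset.sum_lt_sum
    (fun i _ => mul_le_mul_of_nonneg_left (X.beta_le_betaStar i) (hy i).le)
    ⟨k, Finset.mem_univ k, mul_lt_mul_of_pos_left hk (hy k)⟩

end Mixture

/-! ### Integrals and normal components on simplices and facets. -/

namespace Mesh

variable {d : ℕ} {T : Mesh d}

theorem Cell.meas_nonneg (K : T.Cell) : 0 ≤ K.meas := measureReal_nonneg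

theorem Facet.meas_nonneg (e : T.Facet) : 0 ≤ e.meas := measureReal_nonneg

theorem Facet.diam_nonneg (e : T.Facet) : 0 ≤ e.diam := Metric.diam_nonneg

theorem Facet.measurableSet_hull (e : T.Facet) : MeasurableSet e.hull :=
  (e.1.finite_toSet.isCompact_convexHull ℝ).isClosed.measurableSet

theorem Facet.nonempty (e : T.Facet) : e.1.Nonempty := T.nonempty_of_mem_faces e.2.1

theorem Facet.centroid_mem_hull (e : T.Facet) : e.1.centroid ℝ id ∈ e.hull :=
  Finset.centroid_mem_convexHull e.1 e.nonempty

/-- The normal is orthogonal to differences of vertices, so the vertices lie in one hyperplane;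
being convex, it contains their hull. -/
theorem inner_eq_of_mem_hull {K : T.Cell} {e : T.Facet} {n : EuclideanSpace ℝ (Fin d)}
    (hn : IsOutwardUnitNormal K e n) {x y : EuclideanSpace ℝ (Fin d)}
    (hx : x ∈ e.hull) (hy : y ∈ e.hull) : (inner ℝ x n : ℝ) = inner ℝ y n := by
  obtain ⟨v, hv⟩ := e.nonempty
  have hconv : Convex ℝ {z : EuclideanSpace ℝ (Fin d) | (inner ℝ n z : ℝ) = inner ℝ n v} :=
    convex_hyperplane (innerSL ℝ n).toLinearMap.isLinear _
  have key : e.hull ⊆ {z : EuclideanSpace ℝ (Fin d) | (inner ℝ n z : ℝ) = inner ℝ n v} := by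
    refine convexHull_min (fun z hz => ?_) hconv
    have h := hn.2.1 z hz v hv
    rw [inner_sub_right] at h
    exact sub_eq_zero.1 h
  rw [real_inner_comm, real_inner_comm n y]
  exact (key hx).trans (key hy).symm

theorem l2_single [DecidableEq T.Cell] (f : T.Q) (K : T.Cell) :
    l2 f (Pi.single K 1) = f K * K.meas := by
  unfold l2
  rw [Finset.sum_eq_single K]
  · simp [Cell.meas, mul_comm]
  · intro L _ hL
    simp [hL]
  · simp

theorem facetInner_of_eqOn {e : T.Facet} {f : EuclideanSpace ℝ (Fin d) → ℝ} {a : ℝ}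
    (hf : ∀ x ∈ e.hull, f x = a) (b : ℝ) : facetInner e f (fun _ => b) = a * e.meas * b := by
  unfold facetInner
  rw [setIntegral_congr_fun (g := fun _ => a * b) e.measurableSet_hull
    (fun x hx => by simp only [hf x hx]), setIntegral_const]
  simp only [Facet.meas, smul_eq_mul]
  ring

namespace Orientation

variable (o : T.Orientation)

/-- The field is a + b x on K⁺ and x · n_e is constant on e, so the barycentre value represents the
whole facet. -/
theorem inner_eq_normalComp {v : T.VField} (hv : v ∈ o.RT0zero) (e : T.Facet)
    {x : EuclideanSpace ℝ (Fin d)} (hx : x ∈ e.hull) :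
    inner ℝ (v (o.plus e) x) (o.normal e) = o.normalComp v e := by
  obtain ⟨a, b, hab⟩ := hv.1 (o.plus e)
  unfold normalComp
  rw [hab, hab, inner_add_left, inner_add_left, inner_smul_left, inner_smul_left,
    inner_eq_of_mem_hull (o.normal_plus e) hx e.centroid_mem_hull]

/-! ### Orientation, jumps and upwinding. -/

theorem mem_facetsOf {K : T.Cell} {e : T.Facet} :
    e ∈ o.facetsOf K ↔ K = o.plus e ∨ K = o.minus e := by
  simp [facetsOf, o.adjacent]

open Classical in
/-- The sign of the orientation of the facet `e` relative to the outward direction of `K`. -/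
noncomputable def sign (K : T.Cell) (e : T.Facet) : ℝ := if K = o.plus e then 1 else -1

theorem outNormalComp_eq (v : T.VField) (K : T.Cell) (e : T.Facet) :
    o.outNormalComp v K e = o.sign K e * o.normalComp v e := by
  unfold outNormalComp sign
  split_ifs <;> ring

theorem outJump_eq (ψ : T.Q) (K : T.Cell) (e : T.Facet) :
    o.outJump ψ K e = o.sign K e * o.jump ψ e := by
  unfold outJump sign
  split_ifs <;> ring

theorem jump_add_mul (f g : T.Q) (a : ℝ) (e : T.Facet) :
    o.jump (fun K => f K + a * g K) e = o.jump f e + a * o.jump g e := by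
  unfold jump
  ring

theorem jump_sum {ι : Type*} (s : Finset ι) (f : ι → T.Q) (e : T.Facet) :
    o.jump (fun K => ∑ i ∈ s, f i K) e = ∑ i ∈ s, o.jump (f i) e := by
  simp [jump, Finset.sum_sub_distrib]

/-- This is where the maximum principle enters. Boundary facets are covered too: both adjacent
elements coincide there and the jump vanishes. -/
theorem outJump_nonpos_of_isMin {ψ : T.Q} {K : T.Cell} (h : ∀ L, ψ K ≤ ψ L) {e : T.Facet}
    (he : e ∈ o.facetsOf K) : o.outJump ψ K e ≤ 0 := by
  unfold outJump jump
  split_ifs with hK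
  · linarith [h (o.minus e), congrArg ψ hK]
  · linarith [h (o.plus e), congrArg ψ ((o.mem_facetsOf.1 he).resolve_left hK)]

theorem outJump_nonneg_of_isMax {ψ : T.Q} {K : T.Cell} (h : ∀ L, ψ L ≤ ψ K) {e : T.Facet}
    (he : e ∈ o.facetsOf K) : 0 ≤ o.outJump ψ K e := by
  unfold outJump jump
  split_ifs with hK
  · linarith [h (o.minus e), congrArg ψ hK]
  · linarith [h (o.plus e), congrArg ψ ((o.mem_facetsOf.1 he).resolve_left hK)]

/-- Explains why τ_* involves the value in K alone on outflow facets. On inflow facets τ_⋆ keeps the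
upwind value, so no counterpart is needed. -/
theorem upwind_eq_of_outNormalComp_pos {v : T.VField} (c : T.Q) {K : T.Cell} {e : T.Facet}
    (he : e ∈ o.facetsOf K) (h : 0 < o.outNormalComp v K e) : o.upwind v c e = c K := by
  unfold outNormalComp at h
  unfold upwind
  split_ifs at h with hK
  · rw [if_pos h.le, hK]
  · rw [if_neg (by linarith), (o.mem_facetsOf.1 he).resolve_left hK]

theorem upwind_nonneg {v : T.VField} {c : T.Q} (hc : ∀ K, 0 ≤ c K) (e : T.Facet) :
    0 ≤ o.upwind v c e := by
  unfold upwind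
  split_ifs <;> exact hc _

-- The jump of the indicator of K is ±1 on interior facets of K, with the sign of the outward
-- direction, and 0 on facets that do not touch K.
open Classical in
theorem sum_interior_mul_jump_single (A : T.Facet → ℝ) (K : T.Cell) :
    ∑ e ∈ o.interior, A e * o.jump (Pi.single K 1) e
      = ∑ e ∈ o.facetsOf K, if e ∈ o.interior then o.sign K e * A e else 0 := by
  rw [← Finset.sum_filter, ← Finset.sum_filter_add_sum_filter_not o.interior
    (fun e => e ∈ o.facetsOf K), Finset.sum_eq_zero (s := o.interior.filter (· ∉ o.facetsOf K)),
    add_zero]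
  · refine Finset.sum_congr (by ext e; simp [and_comm]) fun e he => ?_
    simp only [Finset.mem_filter, interior, Finset.mem_univ, true_and, mem_facetsOf] at he
    obtain ⟨hK, hne⟩ := he
    unfold jump sign
    by_cases h : K = o.plus e
    · subst h
      rw [if_pos rfl, Pi.single_eq_same, Pi.single_eq_of_ne hne.symm]
      ring
    · have h' := hK.resolve_left h
      subst h'
      rw [if_neg h, Pi.single_eq_same, Pi.single_eq_of_ne hne]
      ring
  · intro e he
    simp only [Finset.mem_filter, mem_facetsOf, not_or] at he
    unfold jump
    rw [Pi.single_eq_of_ne (fun h => he.2.1 h.symm), Pi.single_eq_of_ne (fun h => he.2.2 h.symm)]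
    ring

/-! ### Local form of the weak equations. -/

open Classical in
/-- The net balance of the element `K` for the accumulation density `f`, the constant normal
fluxes `A` and the penalized jumps `D`. -/
noncomputable def cellBalance (ς : ℝ) (kap : T.Facet → ℝ) (f : T.Q) (A D : T.Facet → ℝ) (K : T.Cell) : ℝ :=
  f K * K.meas + ∑ e ∈ o.facetsOf K,
    if e ∈ o.interior then o.sign K e * (A e + ς / e.diam * (kap e * D e)) * e.meas else 0

theorem cellBalance_sum {ι : Type*} (s : Finset ι) (ς : ℝ) (kap : T.Facet → ℝ) (f : ι → T.Q)
    (A D : ι → T.Facet → ℝ) (K : T.Cell) :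
    o.cellBalance ς kap (fun K => ∑ i ∈ s, f i K) (fun e => ∑ i ∈ s, A i e)
      (fun e => ∑ i ∈ s, D i e) K = ∑ i ∈ s, o.cellBalance ς kap (f i) (A i) (D i) K := by
  classical
  induction s using Finset.induction_on with
  | empty => simp [cellBalance]
  | insert a s ha ih =>
    rw [Finset.sum_insert ha, ← ih]
    simp only [Finset.sum_insert ha, cellBalance]
    rw [add_mul, add_add_add_comm, ← Finset.sum_add_distrib]
    congr 1
    refine Finset.sum_congr rfl fun e _ => ?_
    split_ifs <;> ring

theorem cellBalance_eq_zero_of_weak {ς : ℝ} {kap : T.Facet → ℝ} {f b : T.Q}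
    {a : T.Facet → EuclideanSpace ℝ (Fin d) → ℝ} {A : T.Facet → ℝ}
    (ha : ∀ e, ∀ x ∈ e.hull, a e x = A e)
    (h : ∀ q : T.Q, l2 f q + ∑ e ∈ o.interior, facetInner e (a e) (fun _ => o.jump q e)
      + ∑ e ∈ o.interior, ς / e.diam *
          facetInner e (fun _ => kap e * o.jump b e) (fun _ => o.jump q e) = 0) (K : T.Cell) :
    o.cellBalance ς kap f A (o.jump b) K = 0 := by
  classical
  -- Test with the indicator function of K.
  have hK := h (Pi.single K 1)
  rw [l2_single, add_assoc, ← Finset.sum_add_distrib] at hK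
  rw [← hK, cellBalance]
  congr 1
  have key := o.sum_interior_mul_jump_single
    (fun e => (A e + ς / e.diam * (kap e * o.jump b e)) * e.meas) K
  simp only [← mul_assoc] at key ⊢
  rw [← key]
  refine Finset.sum_congr rfl fun e _ => ?_
  rw [facetInner_of_eqOn (ha e), facetInner_of_eqOn (fun _ _ => rfl)]
  ring

/-! ### Flux bounds at extremal elements. -/

-- Facet by facet, inflow and negative jumps of ψ contribute at most 0 and may be dropped, and so
-- may the z-term, since z is minimal in K.
open Classical in
theorem flux_le_sum_outflow {v : T.VField} {c ψ z : T.Q} {ς a : ℝ} {kap : T.Facet → ℝ}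
    (hς : 0 ≤ ς) (ha : 0 ≤ a) (hkap : ∀ e, 0 ≤ kap e) (hc : ∀ K, 0 ≤ c K) {K : T.Cell}
    (hz : ∀ L, z K ≤ z L) :
    (∑ e ∈ o.facetsOf K, if e ∈ o.interior then o.sign K e * (o.upwind v c e * o.normalComp v e
        + ς / e.diam * (kap e * (o.jump ψ e + a * o.jump z e))) * e.meas else 0)
      ≤ ∑ e ∈ (o.facetsOf K).filter (fun e => 0 < o.outNormalComp v K e),
          c K * o.outNormalComp v K e * e.meas
        + ∑ e ∈ (o.facetsOf K).filter (fun e => 0 < o.outJump ψ K e),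
          ς / e.diam * (kap e * o.outJump ψ K e) * e.meas := by
  rw [Finset.sum_filter, Finset.sum_filter, ← Finset.sum_add_distrib]
  refine Finset.sum_le_sum fun e he => ?_
  have hm := e.meas_nonneg
  have hs : 0 ≤ ς / e.diam * kap e := mul_nonneg (div_nonneg hς e.diam_nonneg) (hkap e)
  have h1 : o.upwind v c e * o.outNormalComp v K e * e.meas
      ≤ if 0 < o.outNormalComp v K e then c K * o.outNormalComp v K e * e.meas else 0 := by
    split_ifs with h
    · rw [o.upwind_eq_of_outNormalComp_pos c he h]
    · exact mul_nonpos_of_nonpos_of_nonneg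
        (mul_nonpos_of_nonneg_of_nonpos (o.upwind_nonneg hc e) (not_lt.1 h)) hm
  have h2 : ς / e.diam * (kap e * o.outJump ψ K e) * e.meas
      ≤ if 0 < o.outJump ψ K e then ς / e.diam * (kap e * o.outJump ψ K e) * e.meas else 0 := by
    split_ifs with h
    · exact le_rfl
    · rw [← mul_assoc]
      exact mul_nonpos_of_nonpos_of_nonneg
        (mul_nonpos_of_nonneg_of_nonpos hs (not_lt.1 h)) hm
  have h1' : 0 ≤ if 0 < o.outNormalComp v K e then c K * o.outNormalComp v K e * e.meas else 0 := by
    split_ifs with h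
    · exact mul_nonneg (mul_nonneg (hc K) h.le) hm
    · exact le_rfl
  have h2' : 0 ≤ if 0 < o.outJump ψ K e then
      ς / e.diam * (kap e * o.outJump ψ K e) * e.meas else 0 := by
    split_ifs with h
    · rw [← mul_assoc]
      exact mul_nonneg (mul_nonneg hs h.le) hm
    · exact le_rfl
  have h3 : ς / e.diam * kap e * (a * o.outJump z K e) * e.meas ≤ 0 :=
    mul_nonpos_of_nonpos_of_nonneg (mul_nonpos_of_nonneg_of_nonpos hs
      (mul_nonpos_of_nonneg_of_nonpos ha (o.outJump_nonpos_of_isMin hz he))) hm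
  by_cases hi : e ∈ o.interior
  · rw [if_pos hi]
    refine le_trans (le_of_eq ?_) (add_le_of_nonpos_right h3 |>.trans (add_le_add h1 h2))
    rw [outNormalComp_eq, outJump_eq, outJump_eq]
    ring
  -- Boundary facets carry no flux but are counted on the right, so only the sign of their terms
  -- matters.
  · rw [if_neg hi]
    exact add_nonneg h1' h2'

-- Mirror image at a maximum of z: outflow, positive jumps of ψ and the z-term are all nonnegative.
open Classical in
theorem sum_inflow_le_flux {v : T.VField} {c ψ z : T.Q} {ς a : ℝ} {kap : T.Facet → ℝ}
    (hς : 0 ≤ ς) (ha : 0 ≤ a) (hkap : ∀ e, 0 ≤ kap e) (hc : ∀ K, 0 ≤ c K) {K : T.Cell}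
    (hz : ∀ L, z L ≤ z K) :
    ∑ e ∈ (o.facetsOf K).filter (fun e => o.outNormalComp v K e < 0),
          o.upwind v c e * o.outNormalComp v K e * e.meas
        + ∑ e ∈ (o.facetsOf K).filter (fun e => o.outJump ψ K e < 0),
          ς / e.diam * (kap e * o.outJump ψ K e) * e.meas
      ≤ ∑ e ∈ o.facetsOf K, if e ∈ o.interior then
        o.sign K e * (o.upwind v c e * o.normalComp v e
        + ς / e.diam * (kap e * (o.jump ψ e + a * o.jump z e))) * e.meas else 0 := by
  rw [Finset.sum_filter, Finset.sum_filter, ← Finset.sum_add_distrib]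
  refine Finset.sum_le_sum fun e he => ?_
  have hm := e.meas_nonneg
  have hs : 0 ≤ ς / e.diam * kap e := mul_nonneg (div_nonneg hς e.diam_nonneg) (hkap e)
  have hw := o.upwind_nonneg (v := v) hc e
  have h1 : (if o.outNormalComp v K e < 0 then
      o.upwind v c e * o.outNormalComp v K e * e.meas else 0)
      ≤ o.upwind v c e * o.outNormalComp v K e * e.meas := by
    split_ifs with h
    · exact le_rfl
    · exact mul_nonneg (mul_nonneg hw (not_lt.1 h)) hm
  have h2 : (if o.outJump ψ K e < 0 then ς / e.diam * (kap e * o.outJump ψ K e) * e.meas else 0)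
      ≤ ς / e.diam * (kap e * o.outJump ψ K e) * e.meas := by
    split_ifs with h
    · exact le_rfl
    · rw [← mul_assoc]
      exact mul_nonneg (mul_nonneg hs (not_lt.1 h)) hm
  have h1' : (if o.outNormalComp v K e < 0 then
      o.upwind v c e * o.outNormalComp v K e * e.meas else 0) ≤ 0 := by
    split_ifs with h
    · exact mul_nonpos_of_nonpos_of_nonneg (mul_nonpos_of_nonneg_of_nonpos hw h.le) hm
    · exact le_rfl
  have h2' : (if o.outJump ψ K e < 0 then
      ς / e.diam * (kap e * o.outJump ψ K e) * e.meas else 0) ≤ 0 := by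
    split_ifs with h
    · rw [← mul_assoc]
      exact mul_nonpos_of_nonpos_of_nonneg (mul_nonpos_of_nonneg_of_nonpos hs h.le) hm
    · exact le_rfl
  have h3 : 0 ≤ ς / e.diam * kap e * (a * o.outJump z K e) * e.meas :=
    mul_nonneg (mul_nonneg hs (mul_nonneg ha (o.outJump_nonneg_of_isMax hz he))) hm
  by_cases hi : e ∈ o.interior
  · rw [if_pos hi]
    refine ((add_le_add h1 h2).trans (le_add_of_nonneg_right h3)).trans (le_of_eq ?_)
    rw [outNormalComp_eq, outJump_eq, outJump_eq]
    ring
  · rw [if_neg hi]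
    exact add_nonpos h1' h2'

end Orientation

/-! ### Balance of each component, including the last. -/

section Scheme

variable {m : ℕ} {o : T.Orientation} {X : Mixture (Fin (m + 1))}

theorem sum_components (ct : T.Q) (cp : Fin m → T.Q) (K : T.Cell) :
    ∑ i, components ct cp i K = ct K := by
  simp [components, Fin.sum_univ_castSucc]

/-- The relative increment `(c - cOld) / (c^n (1 - β* c^n))`. -/
noncomputable def relIncrement (X : Mixture (Fin (m + 1))) (cn : Fin (m + 1) → T.Q) (c cOld : T.Q) : T.Q :=
  fun K => (c K - cOld K) / (total cn K * (1 - X.betaStar * total cn K))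

theorem sum_relIncrement (cn c : Fin (m + 1) → T.Q) (K : T.Cell) :
    ∑ i, relIncrement X cn (c i) (cn i) K = relIncrement X cn (total c) (total cn) K := by
  simp only [relIncrement, total]
  rw [← Finset.sum_div, Finset.sum_sub_distrib]

theorem IsLinearIterate.cellBalance_eq_zero {θ ς τ : ℝ} {kap : T.Facet → ℝ}
    {cn : Fin (m + 1) → T.Q} {φn φl : T.Q} {u : Fin (m + 1) → T.VField} {ct : T.Q}
    {cp : Fin m → T.Q} (hu : ∀ i, u i ∈ o.RT0zero)
    (hc : IsLinearIterate o X θ ς τ kap cn φn φl u ct cp) (i : Fin (m + 1)) (K : T.Cell) :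
    o.cellBalance ς kap (fun K => (φl K * components ct cp i K - φn K * cn i K) / τ)
      (fun e => o.upwind (u i) (cn i) e * o.normalComp (u i) e)
      (fun e => o.jump (muOld X cn i) e + θ * gasConstant * X.temp *
        o.jump (relIncrement X cn (components ct cp i) (cn i)) e) K = 0 := by
  have hcast : ∀ i : Fin m, o.cellBalance ς kap
      (fun K => (φl K * components ct cp i.castSucc K - φn K * cn i.castSucc K) / τ)
      (fun e => o.upwind (u i.castSucc) (cn i.castSucc) e * o.normalComp (u i.castSucc) e)
      (fun e => o.jump (muOld X cn i.castSucc) e + θ * gasConstant * X.temp *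
        o.jump (relIncrement X cn (components ct cp i.castSucc) (cn i.castSucc)) e) K = 0 := by
    intro i
    have h := o.cellBalance_eq_zero_of_weak
      (A := fun e => o.upwind (u i.castSucc) (cn i.castSucc) e * o.normalComp (u i.castSucc) e)
      (fun e x hx => by rw [o.inner_eq_normalComp (hu _) e hx]) (hc.component_eq i) K
    have hcomp : components ct cp i.castSucc = cp i := by simp [components]
    simp only [← o.jump_add_mul]
    rw [hcomp]
    exact h
  -- The last component has no equation of its own: its balance is the total balance minus those of
  -- the others, which vanish.
  refine Fin.lastCases ?_ hcast i
  have ht := o.cellBalance_eq_zero_of_weak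
    (A := fun e => ∑ i, o.upwind (u i) (cn i) e * o.normalComp (u i) e)
    (fun e x hx => Finset.sum_congr rfl fun i _ => by rw [o.inner_eq_normalComp (hu _) e hx])
    hc.total_eq K
  have hs := o.cellBalance_sum Finset.univ ς kap
    (fun i K => (φl K * components ct cp i K - φn K * cn i K) / τ)
    (fun i e => o.upwind (u i) (cn i) e * o.normalComp (u i) e)
    (fun i e => o.jump (muOld X cn i) e + θ * gasConstant * X.temp *
      o.jump (relIncrement X cn (components ct cp i) (cn i)) e) K
  rw [Fin.sum_univ_castSucc (n := m), Finset.sum_eq_zero (fun i _ => hcast i), zero_add] at hs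
  rw [← hs, ← ht]
  congr 1
  · funext L
    rw [← Finset.sum_div, Finset.sum_sub_distrib, ← Finset.mul_sum, ← Finset.mul_sum,
      sum_components]
    rfl
  · funext e
    simp only [← o.jump_add_mul]
    rw [← o.jump_sum]
    congr 1
    funext L
    rw [Finset.sum_add_distrib, ← Finset.mul_sum, sum_relIncrement]
    have : total (components ct cp) = ct := funext (sum_components ct cp)
    rw [this]
    rfl

/-! ### Time step quotients and bounds on the increments. -/

variable {θ ς ε τmax τ : ℝ} {kap : T.Facet → ℝ} {cn : Fin (m + 1) → T.Q} {φn φl : T.Q}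
  {u : Fin (m + 1) → T.VField} {δ δlo δup : Fin (m + 1) → ℝ} {ct : T.Q} {cp : Fin m → T.Q}

theorem adaptiveTau_le_tauLower (i : Fin (m + 1)) (K : T.Cell) :
    adaptiveTau o X ς ε τmax kap cn φn φl u δlo δup
      ≤ tauLower o X ς ε kap cn φn φl u δlo i K :=
  (Finset.inf'_le _ (Finset.mem_univ (i, K))).trans ((min_le_left _ _).trans (min_le_left _ _))

theorem adaptiveTau_le_tauUpper (i : Fin (m + 1)) (K : T.Cell) :
    adaptiveTau o X ς ε τmax kap cn φn φl u δlo δup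
      ≤ tauUpper o X ς ε kap cn φn φl u δup i K :=
  (Finset.inf'_le _ (Finset.mem_univ (i, K))).trans ((min_le_left _ _).trans (min_le_right _ _))

-- The filters make every summand nonnegative, and ε excludes a zero denominator, so the quotient
-- can be cleared.
open Classical in
theorem tauLower_denom_pos (hς : 0 ≤ ς) (hε : 0 < ε) (hkap : ∀ e, 0 ≤ kap e)
    {c ψ : T.Q} (hc : ∀ K, 0 ≤ c K) (v : T.VField) (K : T.Cell) :
    0 < ∑ e ∈ (o.facetsOf K).filter (fun e => 0 < o.outNormalComp v K e),
          c K * o.outNormalComp v K e * e.meas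
        + ∑ e ∈ (o.facetsOf K).filter (fun e => 0 < o.outJump ψ K e),
          ς / e.diam * (kap e * o.outJump ψ K e) * e.meas + ε := by
  refine add_pos_of_nonneg_of_pos (add_nonneg (Finset.sum_nonneg fun e he => ?_)
    (Finset.sum_nonneg fun e he => ?_)) hε
  · exact mul_nonneg (mul_nonneg (hc K) (Finset.mem_filter.1 he).2.le) e.meas_nonneg
  · exact mul_nonneg (mul_nonneg (div_nonneg hς e.diam_nonneg)
      (mul_nonneg (hkap e) (Finset.mem_filter.1 he).2.le)) e.meas_nonneg

open Classical in
theorem tauUpper_denom_pos (hς : 0 ≤ ς) (hε : 0 < ε) (hkap : ∀ e, 0 ≤ kap e)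
    {c ψ : T.Q} (hc : ∀ K, 0 ≤ c K) (v : T.VField) (K : T.Cell) :
    0 < -(∑ e ∈ (o.facetsOf K).filter (fun e => o.outNormalComp v K e < 0),
          o.upwind v c e * o.outNormalComp v K e * e.meas
        + ∑ e ∈ (o.facetsOf K).filter (fun e => o.outJump ψ K e < 0),
          ς / e.diam * (kap e * o.outJump ψ K e) * e.meas) + ε := by
  refine add_pos_of_nonneg_of_pos (neg_nonneg.2 (add_nonpos (Finset.sum_nonpos fun e he => ?_)
    (Finset.sum_nonpos fun e he => ?_))) hε
  · exact mul_nonpos_of_nonpos_of_nonneg (mul_nonpos_of_nonneg_of_nonpos (o.upwind_nonneg hc e)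
      (Finset.mem_filter.1 he).2.le) e.meas_nonneg
  · exact mul_nonpos_of_nonpos_of_nonneg (mul_nonpos_of_nonneg_of_nonpos
      (div_nonneg hς e.diam_nonneg) (mul_nonpos_of_nonneg_of_nonpos (hkap e)
      (Finset.mem_filter.1 he).2.le)) e.meas_nonneg

/-- Positivity of both time step quotients forces a positive porosity and element measure. -/
theorem porosity_mul_meas_pos (hς : 0 ≤ ς) (hε : 0 < ε) (hkap : ∀ e, 0 ≤ kap e)
    (i : Fin (m + 1)) (hcn : ∀ K, 0 ≤ cn i K) (hlo : 0 < δlo i) (hup : 0 < δup i) {K : T.Cell}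
    (h1 : 0 < tauLower o X ς ε kap cn φn φl u δlo i K)
    (h2 : 0 < tauUpper o X ς ε kap cn φn φl u δup i K) :
    0 < φl K * (total cn K * (1 - X.betaStar * total cn K)) * K.meas := by
  unfold tauLower at h1
  unfold tauUpper at h2
  have n1 := (div_pos_iff_of_pos_right (tauLower_denom_pos hς hε hkap hcn (u i) K)).1 h1
  have n2 := (div_pos_iff_of_pos_right (tauUpper_denom_pos hς hε hkap hcn (u i) K)).1 h2
  -- Adding the two positive numerators cancels the porosity increment and leaves the claimed
  -- product times δ_{i,1} + δ_{i,2}.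
  refine pos_of_mul_pos_left (b := δlo i + δup i) ?_ (add_pos hlo hup).le
  linarith

theorem neg_le_relIncrement (hX : 0 ≤ θ * gasConstant * X.temp) (hς : 0 ≤ ς) (hε : 0 < ε)
    (hkap : ∀ e, 0 ≤ kap e) (hu : ∀ i, u i ∈ o.RT0zero)
    (hc : IsLinearIterate o X θ ς τ kap cn φn φl u ct cp) (hτ : 0 < τ)
    (hw : ∀ K, 0 < total cn K * (1 - X.betaStar * total cn K))
    (i : Fin (m + 1)) (hcn : ∀ K, 0 ≤ cn i K)
    (hp : ∀ K, 0 < φl K * (total cn K * (1 - X.betaStar * total cn K)) * K.meas)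
    (hle : ∀ K, τ ≤ tauLower o X ς ε kap cn φn φl u δ i K) (K : T.Cell) :
    -δ i ≤ relIncrement X cn (components ct cp i) (cn i) K := by
  -- It suffices to bound the increment on an element where it is smallest.
  obtain ⟨L, hL⟩ := Finite.exists_min (relIncrement X cn (components ct cp i) (cn i))
  refine le_trans ?_ (hL K)
  have hflux := o.flux_le_sum_outflow (v := u i) (ψ := muOld X cn i) hς hX hkap hcn hL
  have hbal := hc.cellBalance_eq_zero hu i L
  have hτle := hle L
  unfold Orientation.cellBalance at hbal
  unfold tauLower at hτle
  rw [le_div_iff₀ (tauLower_denom_pos hς hε hkap hcn (u i) L)] at hτle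
  have hz : components ct cp i L = cn i L + relIncrement X cn (components ct cp i) (cn i) L
      * (total cn L * (1 - X.betaStar * total cn L)) := by
    unfold relIncrement
    rw [div_mul_cancel₀ _ (hw L).ne']
    ring
  have hmul := mul_le_mul_of_nonneg_left hflux hτ.le
  have hτε := mul_pos hτ hε
  rw [div_mul_eq_mul_div, div_add' _ _ _ hτ.ne', div_eq_zero_iff, or_iff_left hτ.ne', hz] at hbal
  -- With w = c^n (1 - β* c^n), the balance reads φ^l w z |L| = -(φ^l - φ^n) c_i^n |L| - τ · flux.
  -- Inserting the flux bound and the time step bound leaves -φ^l w δ_i |L| with τε to spare.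
  refine le_of_mul_le_mul_left ?_ (hp L)
  linarith

theorem relIncrement_le (hX : 0 ≤ θ * gasConstant * X.temp) (hς : 0 ≤ ς) (hε : 0 < ε)
    (hkap : ∀ e, 0 ≤ kap e) (hu : ∀ i, u i ∈ o.RT0zero)
    (hc : IsLinearIterate o X θ ς τ kap cn φn φl u ct cp) (hτ : 0 < τ)
    (hw : ∀ K, 0 < total cn K * (1 - X.betaStar * total cn K))
    (i : Fin (m + 1)) (hcn : ∀ K, 0 ≤ cn i K)
    (hp : ∀ K, 0 < φl K * (total cn K * (1 - X.betaStar * total cn K)) * K.meas)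
    (hle : ∀ K, τ ≤ tauUpper o X ς ε kap cn φn φl u δ i K) (K : T.Cell) :
    relIncrement X cn (components ct cp i) (cn i) K ≤ δ i := by
  obtain ⟨L, hL⟩ := Finite.exists_max (relIncrement X cn (components ct cp i) (cn i))
  refine (hL K).trans ?_
  have hflux := o.sum_inflow_le_flux (v := u i) (ψ := muOld X cn i) hς hX hkap hcn hL
  have hbal := hc.cellBalance_eq_zero hu i L
  have hτle := hle L
  unfold Orientation.cellBalance at hbal
  unfold tauUpper at hτle
  rw [le_div_iff₀ (tauUpper_denom_pos hς hε hkap hcn (u i) L)] at hτle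
  have hz : components ct cp i L = cn i L + relIncrement X cn (components ct cp i) (cn i) L
      * (total cn L * (1 - X.betaStar * total cn L)) := by
    unfold relIncrement
    rw [div_mul_cancel₀ _ (hw L).ne']
    ring
  have hmul := mul_le_mul_of_nonneg_left hflux hτ.le
  have hτε := mul_pos hτ hε
  rw [div_mul_eq_mul_div, div_add' _ _ _ hτ.ne', div_eq_zero_iff, or_iff_left hτ.ne', hz] at hbal
  refine le_of_mul_le_mul_left ?_ (hp L)
  linarith

end Scheme

end Mesh

/-! ### Bounds on the densities of the new iterate. -/

theorem mainTheorem2 {d m : ℕ} (hd : 2 ≤ d) (T : Mesh d) (o : T.Orientation)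
    (X : Mixture (Fin (m + 1)))
    -- stabilization, penalty and time step parameters, permeability on the facets
    (θ ς ε τmax τ : ℝ) (hθ : 0 < θ) (hς : 0 < ς) (hε : 0 < ε)
    (kap : T.Facet → ℝ) (hkap : ∀ e, 0 < kap e)
    -- densities and porosity of the old time level, porosity and velocities of iterate `l`
    (cn : Fin (m + 1) → T.Q) (φn φl : T.Q) (u : Fin (m + 1) → T.VField)
    (hcn : ∀ K, 0 < X.betaStar * Mesh.total cn K ∧ X.betaStar * Mesh.total cn K < 1)
    (hu : ∀ i, u i ∈ o.RT0zero)
    -- the constants `δ_{i,1}`, `δ_{i,2}` and `δ_1`, `δ_2`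
    (δlo δup : Fin (m + 1) → ℝ) (δ₁ δ₂ : ℝ)
    (hδlo : ∀ i, 0 < δlo i ∧ ∀ K, δlo i < cn i K / Mesh.total cn K)
    (hδup : ∀ i, 0 < δup i ∧ ∀ K, δup i < cn i K / Mesh.total cn K)
    (hδ₁ : ∑ i, δlo i ≤ δ₁ ∧ δ₁ < 1) (hδ₂ : ∑ i, δup i ≤ δ₂ ∧ δ₂ < 1)
    -- the time step
    (hτ : τ = Mesh.adaptiveTau o X ς ε τmax kap cn φn φl u δlo δup) (hτ_pos : 0 < τ)
    -- iterate `l + 1`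
    (ct : T.Q) (cp : Fin m → T.Q)
    (hc : Mesh.IsLinearIterate o X θ ς τ kap cn φn φl u ct cp) :
    (∀ K : T.Cell,
      0 < (1 - δ₁ * (1 - X.betaStar * Mesh.total cn K)) * Mesh.total cn K ∧
      (1 - δ₁ * (1 - X.betaStar * Mesh.total cn K)) * Mesh.total cn K ≤ ct K ∧
      ct K ≤ (1 + δ₂ * (1 - X.betaStar * Mesh.total cn K)) * Mesh.total cn K ∧
      (1 + δ₂ * (1 - X.betaStar * Mesh.total cn K)) * Mesh.total cn K < 1 / X.betaStar ∧
      (∀ y ∈ ({fun i => cn i K, fun i => Mesh.components ct cp i K} : Set (Fin (m + 1) → ℝ)),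
        1 / X.betaStar ≤ 1 / X.mixBeta y ∧
        ((∃ i j, X.beta i ≠ X.beta j) → 1 / X.betaStar < 1 / X.mixBeta y))) ∧
    (∀ (i : Fin (m + 1)) (K : T.Cell),
      0 < Mesh.components ct cp i K ∧ Mesh.components ct cp i K ≤ ct K) := by
  
  have hβ := X.betaStar_pos
  have htot : ∀ K, 0 < Mesh.total cn K := fun K => pos_of_mul_pos_right (hcn K).1 hβ.le
  have hw : ∀ K, 0 < Mesh.total cn K * (1 - X.betaStar * Mesh.total cn K) := fun K =>
    mul_pos (htot K) (sub_pos.2 (hcn K).2)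
  have hcpos : ∀ i K, 0 < cn i K := fun i K =>
    (div_pos_iff_of_pos_right (htot K)).1 ((hδlo i).1.trans ((hδlo i).2 K))
  have hX : 0 ≤ θ * gasConstant * X.temp :=
    (mul_pos (mul_pos hθ Mixture.gasConstant_pos) X.temp_pos).le
  have hlow : ∀ i K, τ ≤ Mesh.tauLower o X ς ε kap cn φn φl u δlo i K := fun i K =>
    hτ.trans_le (Mesh.adaptiveTau_le_tauLower i K)
  have hupp : ∀ i K, τ ≤ Mesh.tauUpper o X ς ε kap cn φn φl u δup i K := fun i K =>
    hτ.trans_le (Mesh.adaptiveTau_le_tauUpper i K)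
  -- Positivity of the porosity and of |K| is not assumed; a positive time step forces their product
  -- to be positive. Any one component shows this, and index 0 always exists.
  have hp : ∀ K, 0 < φl K * (Mesh.total cn K * (1 - X.betaStar * Mesh.total cn K)) * K.meas :=
    fun K => Mesh.porosity_mul_meas_pos hς.le hε (fun e => (hkap e).le) 0 (fun K => (hcpos 0 K).le)
      (hδlo 0).1 (hδup 0).1 (hτ_pos.trans_le (hlow 0 K)) (hτ_pos.trans_le (hupp 0 K))
  have hzlo : ∀ i K, -δlo i ≤ Mesh.relIncrement X cn (Mesh.components ct cp i) (cn i) K :=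
    fun i => Mesh.neg_le_relIncrement hX hς.le hε (fun e => (hkap e).le) hu hc hτ_pos hw i
      (fun K => (hcpos i K).le) hp (hlow i)
  have hzup : ∀ i K, Mesh.relIncrement X cn (Mesh.components ct cp i) (cn i) K ≤ δup i :=
    fun i => Mesh.relIncrement_le hX hς.le hε (fun e => (hkap e).le) hu hc hτ_pos hw i
      (fun K => (hcpos i K).le) hp (hupp i)
  have hcnew : ∀ i K, 0 < Mesh.components ct cp i K := by
    intro i K
    have h1 := hzlo i K
    unfold Mesh.relIncrement at h1
    rw [le_div_iff₀ (hw K)] at h1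
    have h2 := (lt_div_iff₀ (htot K)).1 ((hδlo i).2 K)
    -- The lower bound is c_i^n - δ_{i,1} c^n + δ_{i,1} β* (c^n)²; this is the last term.
    have h3 := mul_pos (mul_pos (hδlo i).1 (htot K)) (hcn K).1
    linarith
  have hsum : ∀ K, ∑ i, Mesh.relIncrement X cn (Mesh.components ct cp i) (cn i) K
      = (ct K - Mesh.total cn K) /
        (Mesh.total cn K * (1 - X.betaStar * Mesh.total cn K)) := fun K => by
    rw [Mesh.sum_relIncrement, Mesh.relIncrement, Mesh.total, Mesh.sum_components]
  refine ⟨fun K => ⟨?_, ?_, ?_, ?_, ?_⟩, fun i K => ⟨hcnew i K, ?_⟩⟩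
  · have h1 : 0 < 1 - X.betaStar * Mesh.total cn K := sub_pos.2 (hcn K).2
    refine mul_pos ?_ (htot K)
    -- With x = β* c^n: 1 - δ₁(1 - x) = (1 - x)(1 - δ₁) + x.
    nlinarith [mul_pos h1 (sub_pos.2 hδ₁.2), (hcn K).1]
  · have h1 : -δ₁ ≤ ∑ i, Mesh.relIncrement X cn (Mesh.components ct cp i) (cn i) K := by
      refine (neg_le_neg hδ₁.1).trans ?_
      rw [← Finset.sum_neg_distrib]
      exact Finset.sum_le_sum fun i _ => hzlo i K
    rw [hsum, le_div_iff₀ (hw K)] at h1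
    linarith
  · have h1 : ∑ i, Mesh.relIncrement X cn (Mesh.components ct cp i) (cn i) K ≤ δ₂ :=
      (Finset.sum_le_sum fun i _ => hzup i K).trans hδ₂.1
    rw [hsum, div_le_iff₀ (hw K)] at h1
    linarith
  · rw [lt_div_iff₀ hβ]
    have h1 : 0 < 1 - X.betaStar * Mesh.total cn K := sub_pos.2 (hcn K).2
    -- With x = β* c^n: 1 - (1 + δ₂(1 - x)) x = (1 - x) x (1 - δ₂) + (1 - x)².
    have h2 := mul_pos (mul_pos h1 (hcn K).1) (sub_pos.2 hδ₂.2)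
    have h3 := mul_pos h1 h1
    linarith
  · intro y hy
    have hy' : ∀ i, 0 < y i := by
      rcases hy with rfl | rfl
      · exact fun i => hcpos i K
      · exact fun i => hcnew i K
    exact ⟨one_div_le_one_div_of_le (X.mixBeta_pos hy') (X.mixBeta_le_betaStar hy'),
      fun hne => one_div_lt_one_div_of_lt (X.mixBeta_pos hy') (X.mixBeta_lt_betaStar hy' hne)⟩
  · rw [← Mesh.sum_components ct cp K]
    exact Finset.single_le_sum (f := fun i => Mesh.components ct cp i K)
      (fun j _ => (hcnew j K).le) (Finset.mem_univ i)
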